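/- Fix $n\ge 1$. Let $F$ be the space of semi-infinite forms over $V=\bigoplus_{k\in\mathbb Z+1/2,\,1\le j\le n}\mathbb C v^{(j)}_k\cong\mathbb C^n\otimes\mathbb C[t,t^{-1}]$, $v^{(j)}_k=e_j\otimes t^{-k-1/2}$, where $v^{(j)}_k=v_{n(k-\frac12)+j-\frac12}$ fixes the order of the basis, and let $\bar F$ be its completion with respect to energy. Let $|0\rangle=v_{-1/2}\wedge v_{-3/2}\wedge\cdots$, and let $\langle 0|$ be the left vacuum. Let $\psi^{\pm(j)}_k$ be the fermions ($\psi^{+(j)}_k$ is wedging with $v^{(j)}_{-k}$, $\psi^{-(j)}_k$ is contraction with the dual of $v^{(j)}_k$), $\psi^{\pm(j)}(z)=\sum_k\psi^{\pm(j)}_kz^{-k-1/2}$, $\alpha^{(j)}_k=\sum_p{:}\psi^{+(j)}_p\psi^{-(j)}_{k-p}{:}$, $\Gamma_+(x)=\exp\sum_{j=1}^n\sum_{k\ge1}x^{(j)}_k\alpha^{(j)}_k$, and let $Q_i$ be the operators determined by $Q_i|0\rangle=\psi^{+(i)}_{-1/2}|0\rangle$ and $Q_i\psi^{\pm(j)}_k=(-1)^{\delta_{ij}+1}\psi^{\pm(j)}_{k\mp\delta_{ij}}Q_i$.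 Let $G_\pm$ be the groups of complex $n\times n$ matrix series $f(\zeta)=\mathrm{Id}+\sum_{l>0}f_l\zeta^{\pm l}$ with $f(-\zeta)^tf(\zeta)=\mathrm{Id}$, and $\mathfrak g_-$ the Lie algebra of series $s(\zeta)=\sum_{l>0}s_l\zeta^{-l}$ with $s(-\zeta)^t+s(\zeta)=0$. They act on $V$ (or its completion) by $\zeta\mapsto t^{-1}$, and $G_-$ acts on $F$, $G_+$ on $\bar F$, by $A(v_{i_1}\wedge v_{i_2}\wedge\cdots)=Av_{i_1}\wedge Av_{i_2}\wedge\cdots$. For $A=RS$ with $R\in G_+$ and $S\in G_-$ (in particular for $A\in G_+$ or $A\in G_-$) define the $n\times n$ matrices $\Psi_l=\Psi_l(A,x)$, $l\ge 0$, of formal power series in the variables $x=(x^{(j)}_k)_{1\le j\le n,\,k\ge 1}$ by $$\sum_{l\ge0}\Psi_l(A,x)_{ik}\,z^l=\frac{\langle0|\Gamma_+(x)Q_i^{-1}A\psi^{+(k)}(z)|0\rangle}{\langle0|\Gamma_+(x)A|0\rangle}.$$ For $s\in\mathfrak g_-$ put $s.\Psi_l=\frac{\partial}{\partial\varepsilon}\Psi_l(A\exp(\varepsilon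 s),x)\big|_{\varepsilon=0}$, the derivative being taken coefficientwise in $x$. **Proposition.** Let $A=RS$ be as above and let $s\in\mathfrak g_-$. Then for every $\varepsilon\in\mathbb C$ the series $\langle0|\Gamma_+(x)A\exp(\varepsilon s)|0\rangle$ is invertible, all the derivatives $s.\Psi_l$ exist, and $$-(s.\Psi_3)\Psi_0^t+(s.\Psi_2)\Psi_1^t-(s.\Psi_1)\Psi_2^t+(s.\Psi_0)\Psi_3^t=-\Psi_0s_1\Psi_2^t+\Psi_1s_1\Psi_1^t-\Psi_2s_1\Psi_0^t+\Psi_0s_2\Psi_1^t-\Psi_1s_2\Psi_0^t-\Psi_0s_3\Psi_0^t .$$ -/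

import Mathlib

namespace GiventalKP

/-! ### Semi-infinite forms

A half-integer `i` is encoded by the integer `p = i - 1/2`, so the basis vectors of `V` are
`v_p`, `p : ℤ`. -/

/-- A semi-infinite monomial `v_{p₁} ∧ v_{p₂} ∧ ⋯`, `p₁ > p₂ > ⋯`, `p_{l+1} = p_l - 1` for large `l`,
recorded by its set of indices: a set of integers that is bounded above and contains all
sufficiently negative integers. -/
@[ext]
structure SemiInf where
  carrier : Set ℤ
  bddAbove : BddAbove carrier
  full : ∃ N : ℕ, ∀ p : ℤ, p < -(N : ℤ) → p ∈ carrier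

namespace SemiInf

/-- `|m⟩`: the monomial `v_{m-1} ∧ v_{m-2} ∧ ⋯` (integer labels). -/
def vac (m : ℤ) : SemiInf where
  carrier := Set.Iio m
  bddAbove := ⟨m, fun _ hp => le_of_lt hp⟩
  full := ⟨m.natAbs, fun p hp => by simp only [Set.mem_Iio]; omega⟩

/-- Adjoin the index `p`. -/
def add (I : SemiInf) (p : ℤ) : SemiInf where
  carrier := insert p I.carrier
  bddAbove := I.bddAbove.insert p
  full := by
    obtain ⟨N, hN⟩ := I.full
    exact ⟨N, fun q hq => Or.inr (hN q hq)⟩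

/-- Delete the index `p`. -/
def del (I : SemiInf) (p : ℤ) : SemiInf where
  carrier := I.carrier \ {p}
  bddAbove := I.bddAbove.mono Set.sdiff_subset
  full := by
    obtain ⟨N, hN⟩ := I.full
    refine ⟨N + p.natAbs, fun q hq => ⟨hN q (by rw [Nat.cast_add] at hq; omega), ?_⟩⟩
    simp only [Set.mem_singleton_iff]
    rw [Nat.cast_add] at hq
    omega

/-- The number of indices of `I` greater than `p` (a finite number). -/
noncomputable def above (I : SemiInf) (p : ℤ) : ℕ := {q ∈ I.carrier | p < q}.ncard

open Classical in
/-- The least `N` such that every `p < -N` belongs to `I`. -/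
noncomputable def depth (I : SemiInf) : ℕ := Nat.find I.full

theorem cut_finite (I : SemiInf) (N : ℕ) : {p ∈ I.carrier | -(N : ℤ) ≤ p}.Finite := by
  obtain ⟨B, hB⟩ := I.bddAbove
  exact (Set.finite_Icc (-(N : ℤ)) B).subset fun p hp => ⟨hp.2, hB hp.1⟩

/-- The indices `p ≥ -N` of `I`. -/
noncomputable def cut (I : SemiInf) (N : ℕ) : Finset ℤ := (I.cut_finite N).toFinset

end SemiInf

/-- The completed space of semi-infinite forms: arbitrary, possibly infinite, linear combinations
of semi-infinite monomials, given by their coefficients. The space of semi-infinite forms is the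
subspace of finitely supported functions. -/
abbrev Fock : Type := SemiInf → ℂ

open Classical in
/-- The basis vector of the monomial `I`. -/
noncomputable def basisVec (I : SemiInf) : Fock := Pi.single I 1

open Classical in
/-- The wedging operator `w ↦ v_p ∧ w`. On monomials, `v_p ∧ v_I = (-1)^{#{q ∈ I, q > p}} v_{I ∪ p}`
if `p ∉ I`, and `0` otherwise; below, the coefficient of `v_J` is written out. -/
noncomputable def wedge (p : ℤ) (w : Fock) : Fock := fun J =>
  if p ∈ J.carrier then (-1) ^ J.above p * w (J.del p) else 0

open Classical in
/-- The contracting operator of the functional `v_p^*`: on monomials,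
`v_I ↦ (-1)^{#{q ∈ I, q > p}} v_{I \ p}` if `p ∈ I`, and `0` otherwise. -/
noncomputable def contract (p : ℤ) (w : Fock) : Fock := fun J =>
  if p ∈ J.carrier then 0 else (-1) ^ J.above p * w (J.add p)

/-- The minor of the matrix `a` with rows `P` and columns `Q` (zero unless `#P = #Q`). -/
noncomputable def minor (a : ℤ → ℤ → ℂ) (P Q : Finset ℤ) : ℂ :=
  if h : P.card = Q.card then
    (Matrix.of fun x y : Fin Q.card =>
      a (P.orderEmbOfFin h x) (Q.orderEmbOfFin rfl y)).det
  else 0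

/-- The action on semi-infinite forms of a matrix `a` that is lower or upper triangular with units
on the diagonal, `v_{p₁} ∧ v_{p₂} ∧ ⋯ ↦ a v_{p₁} ∧ a v_{p₂} ∧ ⋯`. The coefficient of `v_J` in the
image of `v_I` is the infinite minor of `a` with rows `J` and columns `I`. Because `a` is
unitriangular, this is the finite minor on the indices `≥ -N`, for any `N` such that `I` and `J`
both contain all indices `< -N`. -/
noncomputable def wedgeAction (a : ℤ → ℤ → ℂ) (w : Fock) : Fock := fun J =>
  ∑ᶠ I : SemiInf,
    minor a (J.cut (max I.depth J.depth)) (I.cut (max I.depth J.depth)) * w I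

/-! ### The `n`-component relabelling

With `j ∈ {0, …, n-1}` and `k = q + 1/2`, the vector `v^{(j)}_k` is `v_p` for `p = n q + j`. -/

section Components

variable {n : ℕ} [NeZero n]

/-- The integer label of `v^{(j)}_{q+1/2}`. -/
def idx (j : Fin n) (q : ℤ) : ℤ := (Int.divModEquiv n).symm (q, j)

/-- The component `j` of the label `p`. -/
def comp (n : ℕ) [NeZero n] (p : ℤ) : Fin n := (Int.divModEquiv n p).2

/-- The level `q` of the label `p`. -/
def level (n : ℕ) [NeZero n] (p : ℤ) : ℤ := (Int.divModEquiv n p).1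

/-- The fermion `ψ^{+(j)}_{-(q+1/2)}`, i.e. wedging with `v^{(j)}_{q+1/2}`. It is the coefficient
of `z^q` in `ψ^{+(j)}(z)`. -/
noncomputable def fermiPlus (j : Fin n) (q : ℤ) : Fock → Fock := wedge (idx j q)

/-- The fermion `ψ^{-(j)}_{q+1/2}`, i.e. contraction with the dual of `v^{(j)}_{q+1/2}`. -/
noncomputable def fermiMinus (j : Fin n) (q : ℤ) : Fock → Fock := contract (idx j q)

/-- The boson `α^{(j)}_k = ∑_q ψ^{+(j)}_{k-(q+1/2)} ψ^{-(j)}_{q+1/2}` for `k ≥ 1` (for these `k` the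
factors anticommute and no normal ordering is needed). Each coefficient is a finite sum. -/
noncomputable def alpha (j : Fin n) (k : ℕ+) (w : Fock) : Fock := fun J =>
  ∑ᶠ q : ℤ, fermiPlus j (q - k) (fermiMinus j q w) J

open Classical in
/-- The image `Q_i v_J`, where `Q_i` is characterised by `Q_i |0⟩ = ψ^{+(i)}_{-1/2} |0⟩`,
`Q_i ψ^{±(j)}_k = (-1)^{δ_{ij}+1} ψ^{±(j)}_{k ∓ δ_{ij}} Q_i`. Write
`v_J = v_{p₁} ∧ ⋯ ∧ v_{p_r} ∧ |-nM⟩`. Moving `Q_i` to the right shifts the vectors of component `i`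
by one level and changes the sign of the others, and
`Q_i |-nM⟩ = v^{(i)}_{-M+1/2} ∧ |-nM⟩`. -/
noncomputable def qBasis (i : Fin n) (J : SemiInf) : Fock :=
  ((J.cut (n * J.depth)).sort (· ≥ ·)).foldr
    (fun p w => if comp n p = i then wedge (p + n) w else -wedge p w)
    (fermiPlus i (-(J.depth : ℤ)) (basisVec (SemiInf.vac (-((n : ℤ) * J.depth)))))

/-- The operator `Q_i⁻¹`. As `Q_i` permutes the semi-infinite monomials up to signs, the matrix of
`Q_i⁻¹` is the transpose of that of `Q_i`. -/
noncomputable def qInv (i : Fin n) (w : Fock) : Fock := fun J =>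
  ∑ᶠ I : SemiInf, qBasis i J I * w I

/-! ### The operator `Γ_+(x)` -/

/-- Monomials in the variables `x^{(j)}_k`, `1 ≤ j ≤ n`, `k ≥ 1`. -/
abbrev Expo (n : ℕ) : Type := Fin n × ℕ+ →₀ ℕ

/-- The operator `∑_{j,k} x^{(j)}_k α^{(j)}_k` on power series in `x` with coefficients in the
completed space of semi-infinite forms. -/
noncomputable def heis (W : Expo n → Fock) : Expo n → Fock := fun m =>
  ∑ a ∈ m.support, alpha a.1 a.2 (W (m - Finsupp.single a 1))

/-- `Γ_+(x) = exp (∑_{j,k} x^{(j)}_k α^{(j)}_k)`; a power `N` of the exponent larger than the degree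
of the monomial `m` does not contribute to the coefficient at `m`. -/
noncomputable def gammaPlus (W : Expo n → Fock) : Expo n → Fock := fun m =>
  ∑ N ∈ Finset.range (m.degree + 1), ((N.factorial : ℂ)⁻¹) • (heis^[N] W) m

open Classical in
/-- The expectation `⟨0| Γ_+(x) w`, a formal power series in `x`. -/
noncomputable def braGamma (w : Fock) : MvPowerSeries (Fin n × ℕ+) ℂ := fun m =>
  gammaPlus (fun m' => if m' = 0 then w else 0) m (SemiInf.vac 0)

end Components

/-! ### Twisted loops -/

/-- One-sided loops: power series with matrix coefficients. The formal variable is `ζ` for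
`G_+` and `ζ⁻¹` for `G_-`, `𝔤_-`. -/
abbrev Loop (n : ℕ) : Type := PowerSeries (Matrix (Fin n) (Fin n) ℂ)

/-- `f(ζ) ↦ f(-ζ)ᵗ`. -/
noncomputable def twist {n : ℕ} (f : Loop n) : Loop n :=
  PowerSeries.mk fun l => (-1 : ℂ) ^ l • (PowerSeries.coeff l f).transpose

/-- The set of `R = 1 + ∑_{l>0} R_l ζ^l` with `R(-ζ)ᵗ R(ζ) = 1`: the group `G_+`, and, in the variable
`ζ⁻¹`, the group `G_-`. -/
def twistedGroup (n : ℕ) : Set (Loop n) :=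
  {f | PowerSeries.coeff 0 f = 1 ∧ twist f * f = 1}

/-- The set of `r = ∑_{l>0} r_l ζ^l` with `r(-ζ)ᵗ + r(ζ) = 0`: the Lie algebra `𝔤_+`, and, in the
variable `ζ⁻¹`, the Lie algebra `𝔤_-`. -/
def twistedAlgebra (n : ℕ) : Set (Loop n) :=
  {f | PowerSeries.coeff 0 f = 0 ∧ twist f + f = 0}

/-- `exp f = ∑_N f^N / N!` for a loop `f` without constant term; only `N ≤ l` contribute to the
coefficient `l`. -/
noncomputable def loopExp {n : ℕ} (f : Loop n) : Loop n :=
  PowerSeries.mk fun l =>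
    ∑ N ∈ Finset.range (l + 1), ((N.factorial : ℂ)⁻¹) • PowerSeries.coeff l (f ^ N)

section Wave

variable {n : ℕ} [NeZero n]

/-- The matrix of `R(ζ) = ∑ R_l ζ^l` on `V`, where `v^{(j)}_{q+1/2} = e_j ⊗ t^{-q-1}` and `ζ` acts
by `t⁻¹`: `v^{(i)}_{q+1/2} ↦ ∑_{l,j} (R_l)_{ji} v^{(j)}_{q+l+1/2}`. -/
noncomputable def plusMatrix (R : Loop n) (p' p : ℤ) : ℂ :=
  if level n p ≤ level n p' then
    PowerSeries.coeff (level n p' - level n p).toNat R (comp n p') (comp n p)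
  else 0

/-- The matrix of `S(ζ) = ∑ S_l ζ^{-l}` on `V`, `ζ⁻¹` acting by `t`:
`v^{(i)}_{q+1/2} ↦ ∑_{l,j} (S_l)_{ji} v^{(j)}_{q-l+1/2}`. -/
noncomputable def minusMatrix (S : Loop n) (p' p : ℤ) : ℂ :=
  if level n p' ≤ level n p then
    PowerSeries.coeff (level n p - level n p').toNat S (comp n p') (comp n p)
  else 0

/-- The action of the loop `A = R S`, `R ∈ G_+`, `S ∈ G_-`, on semi-infinite forms, with values in the
completed space. The case `S = 1` gives the action of `G_+`, the case `R = 1` that of `G_-`. -/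
noncomputable def loopAction (R S : Loop n) (w : Fock) : Fock :=
  wedgeAction (plusMatrix R) (wedgeAction (minusMatrix S) w)

/-- The vacuum `|0⟩`. -/
noncomputable def vacuum : Fock := basisVec (SemiInf.vac 0)

/-- The tau function `⟨0| Γ_+(x) A |0⟩` of `A = R S`. -/
noncomputable def tau (R S : Loop n) : MvPowerSeries (Fin n × ℕ+) ℂ :=
  braGamma (loopAction R S vacuum)

/-- The matrix `Ψ_l(A, x)` of `A = R S`, the coefficient of `z^l` in
`Ψ_{ik}(A, x, z) = ⟨0| Γ_+(x) Q_i⁻¹ A ψ^{+(k)}(z) |0⟩ / ⟨0| Γ_+(x) A |0⟩`. -/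
noncomputable def waveCoeff (R S : Loop n) (l : ℕ) :
    Matrix (Fin n) (Fin n) (MvPowerSeries (Fin n × ℕ+) ℂ) :=
  Matrix.of fun i k =>
    braGamma (qInv i (loopAction R S (fermiPlus k (l : ℤ) vacuum))) * (tau R S)⁻¹

/-- The derivative `s.Ψ_l`, that is `∂/∂ε Ψ_l(A exp(ε s), x)` at `ε = 0`, for `A = R S` and
`s ∈ 𝔤_-`; it is taken coefficientwise in `x`. -/
noncomputable def waveDeriv (R S s : Loop n) (l : ℕ) :
    Matrix (Fin n) (Fin n) (MvPowerSeries (Fin n × ℕ+) ℂ) :=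
  Matrix.of fun i k => fun m =>
    deriv (fun ε : ℂ =>
      MvPowerSeries.coeff m (waveCoeff R (S * loopExp (ε • s)) l i k)) 0

/-- The coefficient `s_l`, as a matrix that is constant in `x`. -/
noncomputable def constCoeff (s : Loop n) (l : ℕ) :
    Matrix (Fin n) (Fin n) (MvPowerSeries (Fin n × ℕ+) ℂ) :=
  (PowerSeries.coeff l s).map (MvPowerSeries.C : ℂ →+* MvPowerSeries (Fin n × ℕ+) ℂ)

end Wave

end GiventalKP

open GiventalKP

/-!
The factor `S ∈ G_-` and the direction `s ∈ 𝔤_-` act on the wave function in a completely explicit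
way. In the variable `ζ⁻¹ = t` a loop of `G_-` lowers the level of the basis vectors, so it maps the
Dirac sea spanned by the `v_p`, `p < 0`, to itself and is unitriangular there. Hence

* it fixes the vacuum (`wedgeAction_vacuum`), so that `⟨0|Γ_+(x) R S|0⟩` does not depend on `S`
  (`tau_eq`); its constant term is `⟨0|R|0⟩ = 1`, so it is invertible (`isUnit_tau`);
* it maps `v^{(k)}_{l+1/2} ∧ |0⟩` to `∑_{m+d=l} ∑_j (S_d)_{jk} v^{(j)}_{m+1/2} ∧ |0⟩`, as the
  components of `S v^{(k)}_{l+1/2}` in the Dirac sea are annihilated by the wedge with the vacuum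
  (`wedgeAction_minusMatrix_fermiPlus`).

Both facts rest on the vanishing of a minor in which some rows are supported on fewer columns
(`minor_eq_zero_of_card_lt`). The remaining operators `R`, `Q_i⁻¹` and `Γ_+(x)` are linear, so the
series `Ψ(z) = ∑_l Ψ_l z^l` satisfies `Ψ(RST, z) = Ψ(RS, z) T(z)` for loops `T` in `ζ⁻¹` with
constant term `1`, `ζ⁻¹` being replaced by `z` (`mk_waveCoeff`, `waveCoeff_mul`). With `T = exp(ε s)`
the coefficients are polynomials in `ε`, and differentiation gives `s.Ψ_l = ∑_{a+d=l} Ψ_a s_d`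
(`waveDeriv_eq`). Substituting this with `s_0 = 0` into the left-hand side of the comparison formula
and expanding gives the right-hand side.
-/

namespace GiventalKP

/-! ### Linearity of the operators -/

theorem wedge_add (p : ℤ) (v w : Fock) : wedge p (v + w) = wedge p v + wedge p w := by
  funext J
  simp only [wedge, Pi.add_apply]
  split_ifs <;> ring

theorem wedge_smul (p : ℤ) (c : ℂ) (w : Fock) : wedge p (c • w) = c • wedge p w := by
  funext J
  simp only [wedge, Pi.smul_apply, smul_eq_mul]
  split_ifs <;> ring

theorem contract_add (p : ℤ) (v w : Fock) : contract p (v + w) = contract p v + contract p w := by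
  funext J
  simp only [contract, Pi.add_apply]
  split_ifs <;> ring

theorem contract_smul (p : ℤ) (c : ℂ) (w : Fock) : contract p (c • w) = c • contract p w := by
  funext J
  simp only [contract, Pi.smul_apply, smul_eq_mul]
  split_ifs <;> ring

section Linearity

variable {n : ℕ} [NeZero n]

theorem idx_eq (j : Fin n) (q : ℤ) : idx j q = q * n + j := by
  simp [idx, Int.divModEquiv]

theorem comp_idx (j : Fin n) (q : ℤ) : comp n (idx j q) = j := by
  rw [idx, comp, Equiv.apply_symm_apply]

theorem level_idx (j : Fin n) (q : ℤ) : level n (idx j q) = q := by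
  rw [idx, level, Equiv.apply_symm_apply]

theorem idx_comp_level (p : ℤ) : idx (comp n p) (level n p) = p := by
  exact (Int.divModEquiv n).symm_apply_apply p

theorem level_eq (p : ℤ) : level n p = p / n := rfl

theorem level_nonneg {p : ℤ} : 0 ≤ level n p ↔ 0 ≤ p := by
  rw [level_eq]
  exact Int.ediv_nonneg_iff_of_pos (by exact_mod_cast Nat.pos_of_neZero n)

/-- For `k ≥ 1` a term of `α_k^{(j)}` contributes to the coefficient of `v_J` only when its level
`q` is unoccupied in `J` while `q - k` is occupied; as `J` agrees with the Dirac sea away from a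
bounded range, this leaves finitely many `q`. -/
theorem finite_support_alpha (j : Fin n) (k : ℕ+) (w : Fock) (J : SemiInf) :
    (Function.support fun q : ℤ => fermiPlus j (q - k) (fermiMinus j q w) J).Finite := by
  obtain ⟨B, hB⟩ := J.bddAbove
  obtain ⟨N, hN⟩ := J.full
  have hn : (1 : ℤ) ≤ n := by exact_mod_cast Nat.pos_of_neZero n
  refine (Set.finite_Icc (-(N : ℤ) - 1) (|B| + k)).subset fun q hq => ?_
  simp only [Function.mem_support, fermiPlus, fermiMinus, wedge, contract] at hq
  have hj : ((j : ℕ) : ℤ) < n := by exact_mod_cast j.2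
  have hj0 : (0 : ℤ) ≤ ((j : ℕ) : ℤ) := by positivity
  have hk : (1 : ℤ) ≤ k := by exact_mod_cast k.pos
  split_ifs at hq with h1 h2
  · exact absurd (mul_zero _) hq
  · have hne : idx j q ≠ idx j (q - k) := fun h => by
      have := congrArg (level n) h
      rw [level_idx, level_idx] at this
      omega
    have hq' : idx j q ∉ J.carrier := fun h => h2 ⟨h, hne⟩
    have h3 := hB h1
    have h4 : -(N : ℤ) ≤ idx j q := by
      by_contra h
      exact hq' (hN _ (by omega))
    rw [idx_eq] at h3 h4
    have h5 := le_abs_self B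
    constructor
    · by_contra h
      have : q + 1 ≤ -N - 1 := by omega
      nlinarith
    · by_contra h
      have : |B| + 1 ≤ q - k := by omega
      nlinarith [abs_nonneg B]
  · exact absurd rfl hq

theorem alpha_add (j : Fin n) (k : ℕ+) (v w : Fock) :
    alpha j k (v + w) = alpha j k v + alpha j k w := by
  funext J
  simp only [alpha, Pi.add_apply]
  rw [← finsum_add_distrib (finite_support_alpha j k v J) (finite_support_alpha j k w J)]
  simp only [fermiPlus, fermiMinus, contract_add, wedge_add, Pi.add_apply]

theorem alpha_smul (j : Fin n) (k : ℕ+) (c : ℂ) (w : Fock) :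
    alpha j k (c • w) = c • alpha j k w := by
  funext J
  simp only [alpha, Pi.smul_apply]
  rw [smul_finsum]
  simp only [fermiPlus, fermiMinus, contract_smul, wedge_smul, Pi.smul_apply]

theorem isLinearMap_heis : IsLinearMap ℂ (heis : (Expo n → Fock) → Expo n → Fock) where
  map_add V W := by
    funext m
    simp only [heis, Pi.add_apply, alpha_add, Finset.sum_add_distrib]
  map_smul c W := by
    funext m
    simp only [heis, Pi.smul_apply, alpha_smul, Finset.smul_sum]

theorem isLinearMap_iterate_heis (N : ℕ) :
    IsLinearMap ℂ (heis : (Expo n → Fock) → Expo n → Fock)^[N] := by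
  induction N with
  | zero => exact ⟨fun _ _ => rfl, fun _ _ => rfl⟩
  | succ N ih =>
    rw [Function.iterate_succ']
    refine ⟨fun V W => ?_, fun c W => ?_⟩
    · simp only [Function.comp_apply, ih.map_add, isLinearMap_heis.map_add]
    · simp only [Function.comp_apply, ih.map_smul, isLinearMap_heis.map_smul]

theorem isLinearMap_gammaPlus :
    IsLinearMap ℂ (gammaPlus : (Expo n → Fock) → Expo n → Fock) where
  map_add V W := by
    funext m
    simp only [gammaPlus, (isLinearMap_iterate_heis _).map_add, Pi.add_apply, smul_add,
      Finset.sum_add_distrib]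
  map_smul c W := by
    funext m
    simp only [gammaPlus, (isLinearMap_iterate_heis _).map_smul, Pi.smul_apply, Finset.smul_sum]
    exact Finset.sum_congr rfl fun N _ => smul_comm _ _ _

theorem braGamma_apply (w : Fock) (m : Expo n) :
    braGamma w m = gammaPlus (Pi.single 0 w) m (SemiInf.vac 0) := by
  classical
  refine congrArg (fun W => gammaPlus W m (SemiInf.vac 0)) (funext fun m' => ?_)
  by_cases hm : m' = 0
  · rw [if_pos hm, hm, Pi.single_eq_same]
  · rw [if_neg hm, Pi.single_eq_of_ne hm]

theorem isLinearMap_braGamma :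
    IsLinearMap ℂ (braGamma : Fock → MvPowerSeries (Fin n × ℕ+) ℂ) := by
  constructor
  · intro v w
    funext m
    change _ = braGamma v m + braGamma w m
    simp only [braGamma_apply, Pi.single_add, isLinearMap_gammaPlus.map_add, Pi.add_apply]
  · intro c w
    funext m
    change _ = c • braGamma w m
    simp only [braGamma_apply, Pi.single_smul, isLinearMap_gammaPlus.map_smul, Pi.smul_apply]

theorem add_del {J : SemiInf} {p : ℤ} (h : p ∈ J.carrier) : (J.del p).add p = J := by
  ext q
  simp only [SemiInf.add, SemiInf.del, Set.mem_insert_iff, Set.mem_sdiff, Set.mem_singleton_iff]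
  by_cases hq : q = p
  · simp [hq, h]
  · simp [hq]

theorem finite_support_basisVec (I : SemiInf) : (Function.support (basisVec I)).Finite := by
  classical
  exact (Set.finite_singleton I).subset Pi.support_single_subset

theorem finite_support_wedge (p : ℤ) {w : Fock} (hw : (Function.support w).Finite) :
    (Function.support (wedge p w)).Finite := by
  refine (hw.image fun I => I.add p).subset fun J hJ => ?_
  simp only [Function.mem_support, wedge] at hJ
  split_ifs at hJ with h
  · exact ⟨J.del p, right_ne_zero_of_mul hJ, add_del h⟩
  · exact absurd rfl hJ

/-- `Q_i v_J` is a finite combination of monomials, so the finite-support sum defining `Q_i⁻¹` is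
never a junk value. -/
theorem finite_support_qBasis (i : Fin n) (J : SemiInf) :
    (Function.support (qBasis i J)).Finite := by
  unfold qBasis
  induction (J.cut (n * J.depth)).sort (· ≥ ·) with
  | nil => exact finite_support_wedge _ (finite_support_basisVec _)
  | cons p L ih =>
    rw [List.foldr_cons]
    split_ifs
    · exact finite_support_wedge _ ih
    · rw [Function.support_neg]
      exact finite_support_wedge _ ih

theorem isLinearMap_qInv (i : Fin n) : IsLinearMap ℂ (qInv i) where
  map_add v w := by
    funext J
    simp only [qInv, Pi.add_apply, mul_add]
    refine finsum_add_distrib ?_ ?_ <;>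
    exact (finite_support_qBasis i J).subset (Function.support_mul_subset_left _ _)
  map_smul c w := by
    funext J
    simp only [qInv, Pi.smul_apply]
    rw [smul_finsum]
    simp only [smul_eq_mul, mul_left_comm c]

end Linearity

theorem wedgeAction_basisVec (a : ℤ → ℤ → ℂ) (I J : SemiInf) :
    wedgeAction a (basisVec I) J =
      minor a (J.cut (max I.depth J.depth)) (I.cut (max I.depth J.depth)) := by
  classical
  unfold wedgeAction
  rw [finsum_eq_single _ I]
  · simp [basisVec]
  · intro K hK
    simp [basisVec, hK]

/-- The action of a triangular matrix is linear on finite combinations of monomials; no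
convergence question arises there. -/
theorem wedgeAction_sum {ι : Type*} (a : ℤ → ℤ → ℂ) (s : Finset ι) (c : ι → ℂ)
    (I : ι → SemiInf) :
    wedgeAction a (∑ x ∈ s, c x • basisVec (I x)) =
      ∑ x ∈ s, c x • wedgeAction a (basisVec (I x)) := by
  classical
  funext J
  simp only [Finset.sum_apply, Pi.smul_apply, wedgeAction_basisVec, smul_eq_mul]
  unfold wedgeAction
  rw [finsum_eq_sum_of_support_subset (s := s.image I)]
  · simp only [Finset.sum_apply, Pi.smul_apply, smul_eq_mul, Finset.mul_sum]
    rw [Finset.sum_comm]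
    refine Finset.sum_congr rfl fun x hx => ?_
    rw [Finset.sum_eq_single_of_mem (I x) (Finset.mem_image_of_mem I hx)]
    · simp [basisVec, mul_comm]
    · intro K _ hK
      simp [basisVec, hK]
  · intro K hK
    by_contra hmem
    refine hK (mul_eq_zero_of_right _ ?_)
    rw [Finset.sum_apply]
    refine Finset.sum_eq_zero fun x hx => ?_
    have : K ≠ I x := fun h => hmem (by
      rw [h]; exact Finset.mem_coe.2 (Finset.mem_image_of_mem I hx))
    simp [basisVec, this]

/-! ### The action of `G_-` on the vacuum and on one-particle states -/

/-- A minor vanishes when the rows in `A` are supported on the columns in `B` and `#B < #A`. -/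
theorem minor_eq_zero_of_card_lt {a : ℤ → ℤ → ℂ} {P Q A B : Finset ℤ} (hA : A ⊆ P)
    (h : ∀ p ∈ A, ∀ q ∈ Q, q ∉ B → a p q = 0) (hcard : B.card < A.card) : minor a P Q = 0 := by
  classical
  unfold minor
  split_ifs with hPQ
  · rw [Matrix.det_apply]
    refine Finset.sum_eq_zero fun σ _ => ?_
    suffices ∃ x, a (P.orderEmbOfFin hPQ (σ x)) (Q.orderEmbOfFin rfl x) = 0 by
      obtain ⟨x, hx⟩ := this
      rw [Finset.prod_eq_zero (Finset.mem_univ x) (by simpa using hx), smul_zero]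
    -- otherwise `σ⁻¹` injects the rows in `A` into the columns in `B`
    by_contra! hne
    refine absurd (Finset.card_le_card_of_injOn
      (s := Finset.univ.filter fun x => P.orderEmbOfFin hPQ (σ x) ∈ A) (t := B)
      (fun x => Q.orderEmbOfFin rfl x) ?_ ?_) ?_
    · intro x hx
      by_contra hB
      exact hne x (h _ (by simpa using hx) _ (Finset.orderEmbOfFin_mem _ _ _) hB)
    · exact fun x _ y _ hxy => (Q.orderEmbOfFin rfl).injective hxy
    · rw [not_le]
      refine hcard.trans_le ?_
      refine Finset.card_le_card_of_surjOn (fun x => P.orderEmbOfFin hPQ (σ x)) fun p hp => ?_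
      have hp' : p ∈ Set.range (P.orderEmbOfFin hPQ) := by
        rw [Finset.range_orderEmbOfFin]; exact hA hp
      obtain ⟨y, rfl⟩ := hp'
      exact ⟨σ.symm y, by simpa using hp, by simp⟩
  · rfl

theorem minor_empty (a : ℤ → ℤ → ℂ) : minor a ∅ ∅ = 1 := by
  rw [minor, dif_pos rfl]
  exact Matrix.det_fin_zero

theorem minor_singleton (a : ℤ → ℤ → ℂ) (p q : ℤ) : minor a {p} {q} = a p q := by
  have h : ({p} : Finset ℤ).card = ({q} : Finset ℤ).card := rfl
  rw [minor, dif_pos h]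
  refine (Matrix.det_fin_one _).trans ?_
  exact congrArg₂ a (Finset.mem_singleton.1 (Finset.orderEmbOfFin_mem {p} h _))
    (Finset.mem_singleton.1 (Finset.orderEmbOfFin_mem {q} rfl _))

theorem mem_cut {I : SemiInf} {N : ℕ} {p : ℤ} :
    p ∈ I.cut N ↔ p ∈ I.carrier ∧ -(N : ℤ) ≤ p := by
  simp [SemiInf.cut]

theorem mem_vac {m p : ℤ} : p ∈ (SemiInf.vac m).carrier ↔ p < m := Iff.rfl

theorem mem_add {I : SemiInf} {p q : ℤ} : q ∈ (I.add p).carrier ↔ q = p ∨ q ∈ I.carrier :=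
  Iff.rfl

theorem mem_of_lt_depth (I : SemiInf) {p : ℤ} (hp : p < -(I.depth : ℤ)) : p ∈ I.carrier := by
  unfold SemiInf.depth at hp
  exact @Nat.find_spec _ (_) I.full p hp

theorem depth_eq_zero {I : SemiInf} (h : ∀ p < 0, p ∈ I.carrier) : I.depth = 0 := by
  refine Nat.le_zero.1 ?_
  unfold SemiInf.depth
  exact @Nat.find_min' _ (_) I.full 0 (by simpa using h)

/-- There are `N` labels between `-N` and `-1`. If all of them are occupied in `J` and `N` is at least
the depth of `J`, then `J` contains the whole Dirac sea. -/
theorem mem_of_card_neg_cut {J : SemiInf} {N : ℕ} (hN : J.depth ≤ N)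
    (h : N ≤ ((J.cut N).filter (· < 0)).card) {p : ℤ} (hp : p < 0) : p ∈ J.carrier := by
  by_cases hp' : p < -(N : ℤ)
  · exact mem_of_lt_depth J (by omega)
  · have hsub : (J.cut N).filter (· < 0) ⊆ Finset.Ico (-(N : ℤ)) 0 := fun q hq => by
      rw [Finset.mem_filter, mem_cut] at hq
      exact Finset.mem_Ico.2 ⟨hq.1.2, hq.2⟩
    have heq := Finset.eq_of_subset_of_card_le hsub (by simpa using h)
    have : p ∈ (J.cut N).filter (· < 0) := heq ▸ Finset.mem_Ico.2 ⟨by omega, hp⟩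
    exact (mem_cut.1 (Finset.mem_filter.1 this).1).1

/-- A matrix that does not map negative labels to non-negative ones cannot raise the number of
particles `v_p`, `p ≥ 0`. So, by the conservation of charge, if `I` contains the Dirac sea and the
matrix element between `v_I` and `v_J` is non-zero, then `J` contains the Dirac sea as well. -/
theorem mem_of_minor_ne_zero {a : ℤ → ℤ → ℂ} (ha : ∀ p q, 0 ≤ p → q < 0 → a p q = 0)
    {I J : SemiInf} (hI : ∀ p < 0, p ∈ I.carrier) {N : ℕ} (hN : J.depth ≤ N)
    (h : minor a (J.cut N) (I.cut N) ≠ 0) :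
    (J.cut N).card = (I.cut N).card ∧ ∀ p < 0, p ∈ J.carrier := by
  have hcard : (J.cut N).card = (I.cut N).card := by
    by_contra hne
    exact h (dif_neg hne)
  refine ⟨hcard, fun p hp => mem_of_card_neg_cut hN ?_ hp⟩
  have hpos : ((J.cut N).filter (¬ · < 0)).card ≤ ((I.cut N).filter (¬ · < 0)).card := by
    by_contra hlt
    rw [not_le] at hlt
    refine h (minor_eq_zero_of_card_lt (Finset.filter_subset (¬ · < 0) _) ?_ hlt)
    intro p hp q hq hqB
    refine ha p q (not_lt.1 (Finset.mem_filter.1 hp).2) ?_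
    by_contra hq0
    exact hqB (Finset.mem_filter.2 ⟨hq, hq0⟩)
  have hneg : ((I.cut N).filter (· < 0)).card = N := by
    have : (I.cut N).filter (· < 0) = Finset.Ico (-(N : ℤ)) 0 := by
      ext q
      rw [Finset.mem_filter, mem_cut, Finset.mem_Ico]
      exact ⟨fun hq => ⟨hq.1.2, hq.2⟩, fun hq => ⟨⟨hI q hq.2, hq.1⟩, hq.2⟩⟩
    simp [this]
  have h1 := Finset.card_filter_add_card_filter_not (s := J.cut N) (· < 0)
  have h2 := Finset.card_filter_add_card_filter_not (s := I.cut N) (· < 0)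
  omega

theorem cut_vac : (SemiInf.vac 0).cut 0 = ∅ := by
  ext p
  simp [mem_cut, mem_vac]

theorem cut_add_vac {p : ℤ} (hp : 0 ≤ p) : ((SemiInf.vac 0).add p).cut 0 = {p} := by
  ext q
  simp only [mem_cut, mem_add, mem_vac, Finset.mem_singleton]
  constructor
  · rintro ⟨h | h, h'⟩
    · exact h
    · simp at h'; omega
  · rintro rfl
    exact ⟨Or.inl rfl, by simpa using hp⟩

/-- A matrix that maps the span of the negative labels to itself fixes the vacuum, the wedge of all
negative labels. Units on the diagonal need not be assumed: `wedgeAction` takes minors only over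
the labels `≥ -N`, here none, and so has them built in. -/
theorem wedgeAction_vacuum {a : ℤ → ℤ → ℂ} (ha : ∀ p q, 0 ≤ p → q < 0 → a p q = 0) :
    wedgeAction a vacuum = vacuum := by
  classical
  funext J
  have hd : (SemiInf.vac 0).depth = 0 := depth_eq_zero fun _ h => h
  rw [vacuum, wedgeAction_basisVec, hd, Nat.zero_max]
  by_cases hJ : J = SemiInf.vac 0
  · rw [hJ, hd, cut_vac, minor_empty, basisVec, Pi.single_eq_same]
  · rw [basisVec, Pi.single_eq_of_ne hJ]
    by_contra h
    obtain ⟨hcard, hsea⟩ := mem_of_minor_ne_zero ha (fun _ h => mem_vac.2 h) le_rfl h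
    have hdJ := depth_eq_zero hsea
    rw [hdJ, cut_vac, Finset.card_empty, Finset.card_eq_zero] at hcard
    refine hJ (SemiInf.ext (Set.ext fun p => ⟨fun hp => ?_, fun hp => hsea p hp⟩))
    by_contra hp0
    have : p ∈ J.cut 0 := mem_cut.2 ⟨hp, by simpa [mem_vac] using hp0⟩
    simp [hcard] at this

/-- Wedging `v_p`, `p ≥ 0`, to the vacuum carries no sign. -/
theorem wedge_vacuum {p : ℤ} (hp : 0 ≤ p) :
    wedge p vacuum = basisVec ((SemiInf.vac 0).add p) := by
  classical
  funext J
  by_cases hJ : J = (SemiInf.vac 0).add p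
  · subst hJ
    have hdel : ((SemiInf.vac 0).add p).del p = SemiInf.vac 0 := by
      ext q
      simp only [SemiInf.add, SemiInf.del, Set.mem_sdiff, Set.mem_insert_iff,
        Set.mem_singleton_iff, mem_vac]
      omega
    have habove : ((SemiInf.vac 0).add p).above p = 0 := by
      unfold SemiInf.above
      convert Set.ncard_empty ℤ
      refine Set.eq_empty_iff_forall_notMem.2 fun q hq => ?_
      have h2 : p < q := hq.2
      rcases mem_add.1 hq.1 with h | h
      · omega
      · rw [mem_vac] at h; omega
    rw [wedge, if_pos (mem_add.2 (Or.inl rfl)), hdel, habove]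
    simp [vacuum, basisVec]
  · rw [basisVec, Pi.single_eq_of_ne hJ, wedge]
    split_ifs with h
    · have : J.del p ≠ SemiInf.vac 0 := fun h' => hJ (by rw [← h', add_del h])
      simp [vacuum, basisVec, this]
    · rfl

theorem add_vac_injective {p q : ℤ} (hp : 0 ≤ p)
    (h : (SemiInf.vac 0).add p = (SemiInf.vac 0).add q) : p = q := by
  have : p ∈ ((SemiInf.vac 0).add q).carrier := h ▸ mem_add.2 (Or.inl rfl)
  rcases mem_add.1 this with h | h
  · exact h
  · rw [mem_vac] at h; omega

/-- A matrix that does not map negative labels to non-negative ones acts on a one-particle state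
`v_q ∧ |0⟩` through its column `q`; the components of the image of `v_q` in the Dirac sea are
annihilated. As in `wedgeAction_vacuum`, the diagonal does not enter. -/
theorem wedgeAction_one_particle {a : ℤ → ℤ → ℂ} (ha : ∀ p q, 0 ≤ p → q < 0 → a p q = 0)
    {q : ℤ} (hq : 0 ≤ q) {s : Finset ℤ} (hs : ∀ p ∈ s, 0 ≤ p)
    (has : ∀ p, 0 ≤ p → p ∉ s → a p q = 0) :
    wedgeAction a (basisVec ((SemiInf.vac 0).add q)) =
      ∑ p ∈ s, a p q • basisVec ((SemiInf.vac 0).add p) := by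
  classical
  have hd : ∀ p : ℤ, ((SemiInf.vac 0).add p).depth = 0 := fun p =>
    depth_eq_zero fun _ h => Or.inr h
  funext J
  rw [wedgeAction_basisVec, hd, Nat.zero_max, Finset.sum_apply]
  simp only [Pi.smul_apply, smul_eq_mul]
  by_cases hJ : ∃ p, 0 ≤ p ∧ J = (SemiInf.vac 0).add p
  · obtain ⟨p, hp, rfl⟩ := hJ
    rw [hd, cut_add_vac hp, cut_add_vac hq, minor_singleton]
    rw [Finset.sum_eq_single p]
    · simp [basisVec]
    · intro r _ hr
      rw [basisVec, Pi.single_eq_of_ne fun h => hr (add_vac_injective hp h).symm, mul_zero]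
    · intro hps
      rw [has p hp hps, zero_mul]
  · rw [Finset.sum_eq_zero]
    · by_contra h
      obtain ⟨hcard, hsea⟩ := mem_of_minor_ne_zero ha (fun _ h => mem_add.2 (Or.inr (mem_vac.2 h))) le_rfl h
      have hdJ := depth_eq_zero hsea
      rw [hdJ, cut_add_vac hq, Finset.card_singleton, Finset.card_eq_one] at hcard
      obtain ⟨p, hp⟩ := hcard
      have hpJ : p ∈ J.cut 0 := by simp [hp]
      rw [mem_cut] at hpJ
      refine hJ ⟨p, by simpa using hpJ.2, SemiInf.ext (Set.ext fun r => ⟨fun hr => ?_, ?_⟩)⟩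
      · by_cases hr0 : r < 0
        · exact Or.inr hr0
        · have : r ∈ J.cut 0 := mem_cut.2 ⟨hr, by simpa using hr0⟩
          exact Or.inl (by simpa [hp] using this)
      · rintro (rfl | hr)
        · exact hpJ.1
        · exact hsea r hr
    · intro p hp
      rw [basisVec, Pi.single_eq_of_ne fun h => hJ ⟨p, hs p hp, h⟩, mul_zero]

/-! ### Wave functions of a product -/

section Wave

variable {n : ℕ} [NeZero n]

theorem minusMatrix_eq_zero (S : Loop n) (p q : ℤ) (hp : 0 ≤ p) (hq : q < 0) :
    minusMatrix S p q = 0 := by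
  refine if_neg fun h => ?_
  have h1 := level_nonneg (n := n).2 hp
  have h2 : ¬ 0 ≤ level n q := fun h => absurd (level_nonneg.1 h) (by omega)
  omega

theorem idx_nonneg (j : Fin n) (m : ℕ) : 0 ≤ idx j (m : ℤ) := by
  rw [idx_eq]; positivity

theorem fermiPlus_vacuum (j : Fin n) (m : ℕ) :
    fermiPlus j m vacuum = basisVec ((SemiInf.vac 0).add (idx j m)) :=
  wedge_vacuum (idx_nonneg j m)

/-- `S v^{(k)}_{l+1/2} ∧ |0⟩ = ∑_{m+d=l} ∑_j (S_d)_{jk} v^{(j)}_{m+1/2} ∧ |0⟩`. -/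
theorem wedgeAction_minusMatrix_fermiPlus (S : Loop n) (k : Fin n) (l : ℕ) :
    wedgeAction (minusMatrix S) (fermiPlus k l vacuum) =
      ∑ x ∈ Finset.HasAntidiagonal.antidiagonal l ×ˢ (Finset.univ : Finset (Fin n)),
        PowerSeries.coeff x.1.2 S x.2 k •
          basisVec ((SemiInf.vac 0).add (idx x.2 x.1.1)) := by
  classical
  rw [fermiPlus_vacuum]
  rw [wedgeAction_one_particle (minusMatrix_eq_zero S) (idx_nonneg k l)
    (s := (Finset.HasAntidiagonal.antidiagonal l ×ˢ (Finset.univ : Finset (Fin n))).image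
      fun x => idx x.2 x.1.1)]
  · rw [Finset.sum_image]
    · refine Finset.sum_congr rfl fun x hx => ?_
      have hx' : x.1.1 + x.1.2 = l := by simpa using hx
      have h1 : ((x.1.1 : ℕ) : ℤ) ≤ l := by omega
      have h2 : ((l : ℤ) - (x.1.1 : ℕ)).toNat = x.1.2 := by omega
      simp only [minusMatrix, level_idx, comp_idx, if_pos h1, h2]
    · rintro ⟨⟨m, d⟩, j⟩ hx ⟨⟨m', d'⟩, j'⟩ hx' h
      have h1 : m + d = l := by simpa using hx
      have h2 : m' + d' = l := by simpa using hx'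
      have hj := congrArg (comp n) h
      have hm := congrArg (level n) h
      simp only [comp_idx] at hj
      simp only [level_idx, Nat.cast_inj] at hm
      have hd : d = d' := by omega
      rw [hj, hm, hd]
  · intro p hp
    obtain ⟨x, _, rfl⟩ := Finset.mem_image.1 hp
    exact idx_nonneg _ _
  · intro p hp hps
    refine if_neg fun hle => hps ?_
    rw [level_idx] at hle
    have h0 := level_nonneg (n := n).2 hp
    refine Finset.mem_image.2 ⟨(((level n p).toNat, l - (level n p).toNat), comp n p), ?_, ?_⟩
    · simp only [Finset.mem_product, Finset.HasAntidiagonal.mem_antidiagonal, Finset.mem_univ, and_true]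
      omega
    · simp only [Int.toNat_of_nonneg h0]
      exact idx_comp_level p

/-- The tau function of `R S` depends only on `R`, because `S` fixes the vacuum. -/
theorem tau_eq (R S : Loop n) : tau R S = braGamma (wedgeAction (plusMatrix R) vacuum) := by
  rw [tau, loopAction, wedgeAction_vacuum (minusMatrix_eq_zero S)]

/-- The constant term of the tau function is the diagonal matrix element `⟨0| R |0⟩ = 1`. -/
theorem isUnit_tau (R S : Loop n) : IsUnit (tau R S) := by
  classical
  rw [MvPowerSeries.isUnit_iff_constantCoeff, tau_eq]
  have h : MvPowerSeries.constantCoeff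
      (braGamma (n := n) (wedgeAction (plusMatrix R) vacuum)) = 1 := by
    change gammaPlus _ 0 _ = _
    have hd : (SemiInf.vac 0).depth = 0 := depth_eq_zero fun _ h => h
    simp [gammaPlus, vacuum, wedgeAction_basisVec, hd, cut_vac, minor_empty]
  rw [h]
  exact isUnit_one

/-- The wave matrix of the factor `R` alone. -/
noncomputable def plusWave (R : Loop n) (l : ℕ) :
    Matrix (Fin n) (Fin n) (MvPowerSeries (Fin n × ℕ+) ℂ) :=
  Matrix.of fun i k =>
    braGamma (qInv i (wedgeAction (plusMatrix R) (fermiPlus k (l : ℤ) vacuum))) *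
      (braGamma (wedgeAction (plusMatrix R) vacuum))⁻¹

/-- A loop as a power series in `z` whose coefficients are matrices constant in `x`. -/
noncomputable def constLoop :
    Loop n →+* PowerSeries (Matrix (Fin n) (Fin n) (MvPowerSeries (Fin n × ℕ+) ℂ)) :=
  PowerSeries.map (RingHom.mapMatrix MvPowerSeries.C)

omit [NeZero n] in
theorem coeff_constLoop (s : Loop n) (l : ℕ) :
    PowerSeries.coeff l (constLoop s) = constCoeff s l := by
  simp [constLoop, constCoeff]

/-- The factor `S` multiplies the generating series `∑_l Ψ_l z^l` on the right by `S`, with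
`ζ⁻¹` replaced by `z`. -/
theorem mk_waveCoeff (R S : Loop n) :
    PowerSeries.mk (waveCoeff R S) = PowerSeries.mk (plusWave R) * constLoop S := by
  ext l : 1
  rw [PowerSeries.coeff_mul, PowerSeries.coeff_mk]
  simp only [PowerSeries.coeff_mk, coeff_constLoop]
  refine Matrix.ext fun i k => ?_
  rw [Matrix.sum_apply]
  simp only [Matrix.mul_apply]
  rw [← Finset.sum_product' (f := fun (x : ℕ × ℕ) j => plusWave R x.1 i j * constCoeff S x.2 j k)]
  simp only [waveCoeff, Matrix.of_apply, tau_eq, loopAction, wedgeAction_minusMatrix_fermiPlus,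
    wedgeAction_sum]
  have hq := map_sum ((isLinearMap_braGamma (n := n)).mk' _ ∘ₗ (isLinearMap_qInv i).mk' _)
    (fun x : (ℕ × ℕ) × Fin n => PowerSeries.coeff x.1.2 S x.2 k •
      wedgeAction (plusMatrix R) (basisVec ((SemiInf.vac 0).add (idx x.2 x.1.1))))
    (Finset.HasAntidiagonal.antidiagonal l ×ˢ (Finset.univ : Finset (Fin n)))
  simp only [map_smul, LinearMap.comp_apply, IsLinearMap.mk'_apply] at hq
  rw [hq, Finset.sum_mul]
  refine Finset.sum_congr rfl fun x _ => ?_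
  rw [constCoeff, Matrix.map_apply, plusWave, Matrix.of_apply, fermiPlus_vacuum,
    MvPowerSeries.smul_eq_C_mul]
  ring

/-- `Ψ(RST, z) = Ψ(RS, z) T(z)`. When `S` and `T` have constant term `1`, this is the transformation of
the wave function under the group law; the identity for other constant terms reflects that
`wedgeAction` normalises the diagonal on the Dirac sea to `1`. -/
theorem waveCoeff_mul (R S T : Loop n) (l : ℕ) :
    waveCoeff R (S * T) l =
      ∑ x ∈ Finset.HasAntidiagonal.antidiagonal l, waveCoeff R S x.1 * constCoeff T x.2 := by
  have h : PowerSeries.mk (waveCoeff R (S * T)) =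
      PowerSeries.mk (waveCoeff R S) * constLoop T := by
    rw [mk_waveCoeff, mk_waveCoeff, map_mul, mul_assoc]
  have := congrArg (PowerSeries.coeff l) h
  simpa only [PowerSeries.coeff_mul, PowerSeries.coeff_mk, coeff_constLoop] using this

/-! ### The derivative along `𝔤_-` -/

omit [NeZero n] in
/-- To first order in `ε`, `exp (ε s)` is `1 + ε s`; when `s` has no constant term the coefficients
are polynomials in `ε`. -/
theorem hasDerivAt_loopExp {s : Loop n} (hs : PowerSeries.coeff 0 s = 0) (d : ℕ) (j k : Fin n) :
    HasDerivAt (fun ε : ℂ => PowerSeries.coeff d (loopExp (ε • s)) j k)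
      (PowerSeries.coeff d s j k) 0 := by
  have hexp : (fun ε : ℂ => PowerSeries.coeff d (loopExp (ε • s)) j k) = fun ε =>
      ∑ N ∈ Finset.range (d + 1),
        ε ^ N * ((N.factorial : ℂ)⁻¹ * PowerSeries.coeff d (s ^ N) j k) := by
    funext ε
    rw [loopExp, PowerSeries.coeff_mk, Matrix.sum_apply]
    refine Finset.sum_congr rfl fun N _ => ?_
    rw [smul_pow, Matrix.smul_apply]
    change _ • (ε ^ N • PowerSeries.coeff d (s ^ N)) j k = _
    rw [Matrix.smul_apply, smul_eq_mul, smul_eq_mul]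
    ring
  rw [hexp]
  have hder := HasDerivAt.fun_sum (u := Finset.range (d + 1)) fun N _ =>
    (hasDerivAt_pow N (0 : ℂ)).mul_const
      ((N.factorial : ℂ)⁻¹ * PowerSeries.coeff d (s ^ N) j k)
  refine hder.congr_deriv (Eq.symm ?_)
  rcases d with _ | d
  · simp [hs]
  -- only the linear term of the exponential survives at `ε = 0`
  · rw [Finset.sum_eq_single 1]
    · simp
    · rintro (_ | _ | N) _ hN
      · simp
      · exact absurd rfl hN
      · simp
    · intro h
      exact absurd (Finset.mem_range.2 (by omega)) h

theorem hasDerivAt_waveCoeff (R S : Loop n) {s : Loop n} (hs : PowerSeries.coeff 0 s = 0)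
    (l : ℕ) (i k : Fin n) (m : Expo n) :
    HasDerivAt (fun ε : ℂ =>
        MvPowerSeries.coeff m (waveCoeff R (S * loopExp (ε • s)) l i k))
      (MvPowerSeries.coeff m
        ((∑ x ∈ Finset.HasAntidiagonal.antidiagonal l, waveCoeff R S x.1 * constCoeff s x.2) i k)) 0 := by
  simp only [waveCoeff_mul, Matrix.sum_apply, Matrix.mul_apply, map_sum, constCoeff,
    Matrix.map_apply, MvPowerSeries.coeff_mul_C]
  exact HasDerivAt.fun_sum fun x _ => HasDerivAt.fun_sum fun j _ =>
    (hasDerivAt_loopExp hs x.2 j k).const_mul _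

/-- The derivative along `s` is right multiplication of the wave series by `s(z)`:
`s.Ψ_l = ∑_{a+d=l} Ψ_a s_d`. -/
theorem waveDeriv_eq (R S : Loop n) {s : Loop n} (hs : PowerSeries.coeff 0 s = 0) (l : ℕ) :
    waveDeriv R S s l =
      ∑ x ∈ Finset.HasAntidiagonal.antidiagonal l, waveCoeff R S x.1 * constCoeff s x.2 := by
  refine Matrix.ext fun i k => MvPowerSeries.ext fun m => ?_
  exact (hasDerivAt_waveCoeff R S hs l i k m).deriv

end Wave

end GiventalKP

theorem mainTheorem9 (n : ℕ) [NeZero n] (R S s : Loop n)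
    (hR : R ∈ twistedGroup n) (hS : S ∈ twistedGroup n) (hs : s ∈ twistedAlgebra n) :
    -- the tau function of `A exp(ε s)` is invertible, so the wave functions are defined
    (∀ ε : ℂ, IsUnit (tau R (S * loopExp (ε • s)))) ∧
    -- the derivatives `s.Ψ_l` exist
    (∀ (l : ℕ) (i k : Fin n) (m : Expo n), DifferentiableAt ℂ (fun ε : ℂ =>
      MvPowerSeries.coeff m (waveCoeff R (S * loopExp (ε • s)) l i k)) 0) ∧
    -- the comparison formula
    -(waveDeriv R S s 3) * (waveCoeff R S 0).transpose
        + waveDeriv R S s 2 * (waveCoeff R S 1).transpose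
        - waveDeriv R S s 1 * (waveCoeff R S 2).transpose
        + waveDeriv R S s 0 * (waveCoeff R S 3).transpose
      = -(waveCoeff R S 0 * constCoeff s 1 * (waveCoeff R S 2).transpose)
        + waveCoeff R S 1 * constCoeff s 1 * (waveCoeff R S 1).transpose
        - waveCoeff R S 2 * constCoeff s 1 * (waveCoeff R S 0).transpose
        + waveCoeff R S 0 * constCoeff s 2 * (waveCoeff R S 1).transpose
        - waveCoeff R S 1 * constCoeff s 2 * (waveCoeff R S 0).transpose
        - waveCoeff R S 0 * constCoeff s 3 * (waveCoeff R S 0).transpose := by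
  have h0 := hs.1
  refine ⟨fun ε => isUnit_tau R _,
    fun l i k m => (hasDerivAt_waveCoeff R S h0 l i k m).differentiableAt, ?_⟩
  have hc : constCoeff s 0 = 0 := by
    simp [constCoeff, h0]
  simp only [waveDeriv_eq R S h0, Finset.Nat.antidiagonal_succ, Finset.Nat.antidiagonal_zero,
    Finset.sum_cons, Finset.map_singleton, Finset.sum_singleton, Finset.map_cons,
    Function.Embedding.prodMap, Function.Embedding.coeFn_mk, Prod.map,
    Function.Embedding.refl_apply, hc, mul_zero, Nat.succ_eq_add_one, Nat.reduceAdd]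
  noncomm_ring
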